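/- **Proposition 3.17.** Let $E$ be a (real) Banach lattice, $Y$ a (real) Banach space and $T:E\to Y$ a bounded linear operator. For $S\subset E$ put $\mathrm{sol}(S)=\{x\in E:\ |x|\le |y| \text{ for some } y\in S\}$. A net $(x_\alpha)$ in $E$ is called uaw-null if, for every $u\in E$ with $u\ge 0$, the net $(|x_\alpha|\wedge u)$ converges weakly to $0$. The operator $T$ is called almost Dunford–Pettis if $\|Tx_n\|\to 0$ for every weakly null sequence $(x_n)$ in $E$ that is disjoint (that is, $|x_m|\wedge|x_n|=0$ for $m\ne n$). For a norm bounded set $S\subset E$, the operator $T$ is called $S$-L-weakly compact if $\|Tx_n\|\to0$ for every uaw-null sequence $(x_n)$ in $\mathrm{sol}(S)$. The following statements are equivalent: 1. $T$ is almost Dunford–Pettis. 2. For every relatively weakly compact subset $S$ of $E$, the operator $T$ is $S$-L-weakly compact. 3. For every relatively weakly compact subset $S$ of $E$ and every uaw-null net $(x_\alpha)$ in $\mathrm{sol}(S)$, we have $\|Tx_\alpha\|\to 0$. 4. For every relatively weakly compact subset $S$ of $E$ and every uaw-null sequence $(x_n)$ in $\mathrm{sol}(S)$, we have $\|Tx_n\|\to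 0$. -/

import Mathlib

open Filter Topology

namespace BanachLatticeOps

section Lattice

variable {E : Type*} [NormedAddCommGroup E] [NormedSpace ℝ E] [Lattice E]

/-- The solid hull `sol(A) = {x | ∃ y ∈ A, |x| ≤ |y|}` of a subset of a vector lattice. -/
def sol (A : Set E) : Set E := {x | ∃ y ∈ A, |x| ≤ |y|}

/-- A sequence is disjoint if its terms are pairwise disjoint: `|xₘ| ∧ |xₙ| = 0` for `m ≠ n`. -/
def IsDisjointSeq (x : ℕ → E) : Prop := ∀ m n, m ≠ n → |x m| ⊓ |x n| = 0

/-- Unbounded absolutely weak (uaw) convergence of a family `x` to `a` along a filter `l`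
(for a net, the filter `atTop` of its directed index set):
for every `u ≥ 0` in `E`, `|xᵢ - a| ∧ u` converges to `0` in the weak topology. -/
def UAWTendsto {ι : Type*} (x : ι → E) (l : Filter ι) (a : E) : Prop :=
  ∀ u : E, 0 ≤ u →
    Tendsto (fun i => toWeakSpace ℝ E (|x i - a| ⊓ u)) l (𝓝 (toWeakSpace ℝ E 0))

variable {Y : Type*} [NormedAddCommGroup Y] [NormedSpace ℝ Y]

/-- `T` is almost Dunford-Pettis: it maps disjoint weakly null sequences to norm null ones. -/
def IsAlmostDunfordPettis (T : E →L[ℝ] Y) : Prop :=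
  ∀ x : ℕ → E, IsDisjointSeq x →
    Tendsto (fun n => toWeakSpace ℝ E (x n)) atTop (𝓝 (toWeakSpace ℝ E 0)) →
    Tendsto (fun n => T (x n)) atTop (𝓝 0)

/-- `T` is `S`-L-weakly compact (the notion is meant for norm bounded `S`): it maps
uaw-null sequences of `sol(S)` to norm null ones. -/
def IsLWeaklyCompactOn (S : Set E) (T : E →L[ℝ] Y) : Prop :=
  ∀ x : ℕ → E, (∀ n, x n ∈ sol S) → UAWTendsto x atTop 0 →
    Tendsto (fun n => T (x n)) atTop (𝓝 0)

end Lattice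

/-- `S` is relatively weakly compact: its closure in the weak topology is weakly compact. -/
def IsRelativelyWeaklyCompact {E : Type*} [NormedAddCommGroup E] [NormedSpace ℝ E]
    (S : Set E) : Prop :=
  IsCompact (closure (toWeakSpace ℝ E '' S))

end BanachLatticeOps

open BanachLatticeOps

universe u v w

/-!
The solid seminorm `p x = sup {‖T z‖ : |z| ≤ |x|}` is monotone in `|x|`, and `T` is null on the
disjoint sequences of a solid set exactly when `p` is.

Disjoint sequences in the solid hull of a relatively weakly compact set are weakly null: for a
functional `f` the parts of `|f|` carried by the principal bands of the terms have a bounded sum, so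
they give absolutely summable functionals, to which the Schur property of `ℓ¹` applies. Hence, if
`T` is almost Dunford-Pettis, `p` is null on disjoint sequences of `sol S` for `S` relatively weakly
compact, in particular on disjoint sequences of order intervals.

For a uaw-null family `x` in `sol S` one estimates `p x ≤ p (|x| ⊓ u) + p (|x| - u)⁺`. The second
term is uniformly small on `sol S` for a suitable `u`, since otherwise a gliding hump yields a
disjoint sequence of `sol S` on which `p` is not null. The first term tends to zero because a
positive weakly null family in `[0, u]` is `p`-null: some positive functional `G` satisfies
`p y < ε` for all `y ∈ [0, u]` with `G y` small. To find `G`, add up functionals dominated by `p`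
that norm a sequence of bad elements; `p` being null on disjoint sequences of `[0, u]` makes
monotone sequences of `[0, u]` `p`-Cauchy, and therefore the summation must stop.
-/

namespace BanachLatticeOps

lemma inf_eq_zero_of_le {α : Type*} [Lattice α] [Zero α] {a b c d : α} (ha : 0 ≤ a)
    (hb : 0 ≤ b) (hac : a ≤ c) (hbd : b ≤ d) (h : c ⊓ d = 0) : a ⊓ b = 0 :=
  le_antisymm ((inf_le_inf hac hbd).trans h.le) (le_inf ha hb)

section LatticeGroup

variable {G : Type*} [AddCommGroup G] [Lattice G] [IsOrderedAddMonoid G]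

lemma add_inf_le_inf_add_inf {a b c : G} (ha : 0 ≤ a) (hb : 0 ≤ b) (hc : 0 ≤ c) :
    (a + b) ⊓ c ≤ a ⊓ c + b ⊓ c := by
  rw [← sub_le_iff_le_add', sub_inf]
  refine sup_le (le_inf ?_ ?_) ((sub_nonpos.2 inf_le_right).trans (le_inf hb hc))
  · exact sub_le_iff_le_add'.2 inf_le_left
  · exact (sub_le_self _ ha).trans inf_le_right

lemma sum_inf_le_sum_inf {ι : Type*} {a : ι → G} {c : G} (ha : ∀ i, 0 ≤ a i) (hc : 0 ≤ c)
    (s : Finset ι) : (∑ i ∈ s, a i) ⊓ c ≤ ∑ i ∈ s, a i ⊓ c := by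
  classical
  induction s using Finset.induction_on with
  | empty => simp only [Finset.sum_empty, inf_le_left]
  | insert k s hk ih =>
    rw [Finset.sum_insert hk, Finset.sum_insert hk]
    exact (add_inf_le_inf_add_inf (ha k) (Finset.sum_nonneg fun i _ => ha i) hc).trans
      (add_le_add_right ih _)

lemma nsmul_inf_nsmul_eq_zero {a b : G} (ha : 0 ≤ a) (hb : 0 ≤ b) (h : a ⊓ b = 0) (k : ℕ) :
    k • a ⊓ k • b = 0 := by
  have nsmul_inf_eq_zero {a b : G} (ha : 0 ≤ a) (hb : 0 ≤ b) (h : a ⊓ b = 0) : k • a ⊓ b = 0 := by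
    refine le_antisymm ?_ (le_inf (nsmul_nonneg ha k) hb)
    simpa [h] using sum_inf_le_sum_inf (fun _ : ℕ => ha) hb (Finset.range k)
  refine nsmul_inf_eq_zero ha (nsmul_nonneg hb k) ?_
  rw [inf_comm] at h ⊢
  exact nsmul_inf_eq_zero hb ha h

lemma sum_le_of_pairwise_disjoint {ι : Type*} {a : ι → G} {y : G} (hy : 0 ≤ y)
    (ha : ∀ i, 0 ≤ a i) (hay : ∀ i, a i ≤ y) (hd : ∀ i j, i ≠ j → a i ⊓ a j = 0)
    (s : Finset ι) : ∑ i ∈ s, a i ≤ y := by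
  classical
  induction s using Finset.induction_on with
  | empty => simpa using hy
  | insert k s hk ih =>
    have hdisj : (∑ i ∈ s, a i) ⊓ a k ≤ 0 := by
      refine (sum_inf_le_sum_inf ha (ha k) s).trans_eq (Finset.sum_eq_zero fun i hi => ?_)
      exact hd i k (ne_of_mem_of_not_mem hi hk)
    calc ∑ i ∈ insert k s, a i = (∑ i ∈ s, a i) ⊓ a k + (∑ i ∈ s, a i) ⊔ a k := by
          rw [Finset.sum_insert hk, inf_add_sup, add_comm]
      _ ≤ 0 + y := add_le_add hdisj (sup_le ih (hay k))
      _ = y := zero_add y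

lemma exists_add_of_abs_le_add {z a b : G} (ha : 0 ≤ a) (hb : 0 ≤ b) (hz : |z| ≤ a + b) :
    ∃ z₁ z₂, z = z₁ + z₂ ∧ |z₁| ≤ a ∧ |z₂| ≤ b := by
  obtain ⟨hz, hz'⟩ := abs_le'.1 hz
  have hna : -a ≤ a := (neg_nonpos.2 ha).trans ha
  refine ⟨z ⊓ a ⊔ -a, z - (z ⊓ a ⊔ -a), by abel, abs_le'.2 ⟨sup_le inf_le_right hna, ?_⟩,
    abs_le'.2 ⟨?_, ?_⟩⟩
  · exact neg_le.1 le_sup_right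
  · rw [sub_sup, sub_inf, sub_self]
    exact inf_le_left.trans (sup_le hb (sub_le_iff_le_add'.2 hz))
  · rw [neg_le, sub_sup, sub_inf, sub_self, sub_neg_eq_add]
    refine le_inf ((neg_nonpos.2 hb).trans le_sup_left) ?_
    calc -b = -(a + b) + a := by abel
      _ ≤ z + a := by gcongr; exact neg_le.1 hz'

lemma posPart_add_le (a b : G) : (a + b)⁺ ≤ a⁺ + b⁺ :=
  sup_le (add_le_add (le_posPart a) (le_posPart b))
    (add_nonneg (posPart_nonneg a) (posPart_nonneg b))

lemma posPart_inf_posPart_sub_eq_zero (a b : G) : (a - b)⁺ ⊓ (b - a)⁺ = 0 := by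
  rw [← neg_sub a b, posPart_neg, posPart_inf_negPart_eq_zero]

lemma posPart_sub_inf_le (y s t : G) : (y - s ⊓ t)⁺ ≤ (y - s)⁺ + (y - t)⁺ := by
  refine sup_le ?_ (add_nonneg (posPart_nonneg _) (posPart_nonneg _))
  rw [sub_inf]
  refine sup_le ((le_posPart _).trans ?_) ((le_posPart _).trans ?_)
  · exact le_add_of_nonneg_right (posPart_nonneg _)
  · exact le_add_of_nonneg_left (posPart_nonneg _)

lemma inf_add_posPart_sub (x u : G) : x ⊓ u + (x - u)⁺ = x := by
  rw [inf_eq_sub_posPart_sub, sub_add_cancel]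

/-- The `j`-th term measures how `[a, b]` crosses the layer from `j • e` to `(j + 1) • e`. -/
lemma posPart_sub_le_sum_layers {a b e : G} (he : 0 ≤ e) (ha : 0 ≤ a) {J : ℕ} (hb : b ≤ J • e) :
    (b - a - 2 • e)⁺ ≤ ∑ j ∈ Finset.range J, (b - (j + 1) • e)⁺ ⊓ (j • e - a)⁺ := by
  let D := (b - a - 2 • e)⁺
  let c (j : ℕ) := (b - (j + 1) • e)⁺
  let f (j : ℕ) := (j • e - a)⁺
  have hstep (j : ℕ) : D ⊓ c j ≤ D ⊓ c (j + 1) + c j ⊓ f j := by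
    have hD : D ≤ c (j + 1) + f j := by
      convert posPart_add_le (b - (j + 1 + 1) • e) (j • e - a) using 2
      simp only [add_nsmul, one_nsmul, two_nsmul]
      abel
    calc D ⊓ c j = (c (j + 1) + f j) ⊓ (D ⊓ c j) := (inf_eq_right.2 (inf_le_left.trans hD)).symm
      _ ≤ c (j + 1) ⊓ (D ⊓ c j) + f j ⊓ (D ⊓ c j) := add_inf_le_inf_add_inf
          (posPart_nonneg _) (posPart_nonneg _) (le_inf (posPart_nonneg _) (posPart_nonneg _))
      _ ≤ D ⊓ c (j + 1) + c j ⊓ f j := add_le_add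
          (le_inf (inf_le_right.trans inf_le_left) inf_le_left)
          (le_inf (inf_le_right.trans inf_le_right) inf_le_left)
  have hsum (k : ℕ) : D ⊓ c 0 ≤ D ⊓ c k + ∑ j ∈ Finset.range k, c j ⊓ f j := by
    induction k with
    | zero => simp only [Finset.range_zero, Finset.sum_empty, add_zero, le_refl]
    | succ k ih =>
      rw [Finset.sum_range_succ, add_comm (∑ j ∈ _, _), ← add_assoc]
      exact ih.trans (add_le_add_left (hstep k) _)
  have hD0 : D ≤ c 0 := by
    refine posPart_mono (sub_nonneg.1 ?_)
    convert add_nonneg ha he using 1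
    rw [zero_add, one_nsmul, two_nsmul]; abel
  have hcJ : c J = 0 :=
    posPart_eq_zero.2 (sub_nonpos.2 (hb.trans (nsmul_le_nsmul_left he J.le_succ)))
  calc D = D ⊓ c 0 := (inf_eq_left.2 hD0).symm
    _ ≤ D ⊓ c J + ∑ j ∈ Finset.range J, c j ⊓ f j := hsum J
    _ = ∑ j ∈ Finset.range J, c j ⊓ f j := by
      rw [hcJ, inf_eq_right.2 (posPart_nonneg _), zero_add]

end LatticeGroup

section VectorLattice

variable {E : Type*} [AddCommGroup E] [Module ℝ E] [Lattice E] [IsOrderedModule ℝ E]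

lemma abs_smul_le (r : ℝ) (x : E) : |r • x| ≤ |r| • |x| := by
  rcases le_total 0 r with hr | hr
  · rw [abs_of_nonneg hr]
    refine abs_le'.2 ⟨smul_le_smul_of_nonneg_left (le_abs_self x) hr, ?_⟩
    rw [← smul_neg]
    exact smul_le_smul_of_nonneg_left (neg_le_abs x) hr
  · rw [abs_of_nonpos hr]
    refine abs_le'.2 ⟨?_, ?_⟩
    · rw [← neg_smul_neg]
      exact smul_le_smul_of_nonneg_left (neg_le_abs x) (neg_nonneg.2 hr)
    · rw [← neg_smul]
      exact smul_le_smul_of_nonneg_left (le_abs_self x) (neg_nonneg.2 hr)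

lemma posPart_smul_le {r : ℝ} (hr : 0 ≤ r) (x : E) : (r • x)⁺ ≤ r • x⁺ :=
  sup_le (smul_le_smul_of_nonneg_left (le_posPart x) hr) (smul_nonneg hr (posPart_nonneg x))

lemma posPart_smul_of_nonneg {r : ℝ} (hr : 0 ≤ r) (x : E) : (r • x)⁺ = r • x⁺ := by
  refine (posPart_smul_le hr x).antisymm ?_
  rcases hr.eq_or_lt with rfl | hr'
  · rw [zero_smul]; exact posPart_nonneg _
  · have h := smul_le_smul_of_nonneg_left (posPart_smul_le (inv_nonneg.2 hr) (r • x)) hr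
    rwa [smul_smul, smul_smul, inv_mul_cancel₀ hr'.ne', mul_inv_cancel₀ hr'.ne', one_smul,
      one_smul] at h

variable [IsOrderedAddMonoid E]

lemma posPart_sub_smul_inf_posPart_sub_eq_zero {a b c : E} {C : ℝ} (hC : 1 ≤ C) (h : b ≤ C • c) :
    (b - C • a)⁺ ⊓ (a - c)⁺ = 0 := by
  have hC0 : 0 ≤ C := zero_le_one.trans hC
  refine inf_eq_zero_of_le (posPart_nonneg _) (posPart_nonneg _) le_rfl ?_
    (posPart_inf_posPart_sub_eq_zero b (C • a))
  calc (a - c)⁺ ≤ C • (a - c)⁺ := le_smul_of_one_le_left (posPart_nonneg _) hC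
    _ = (C • a - C • c)⁺ := by rw [← posPart_smul_of_nonneg hC0, smul_sub]
    _ ≤ (C • a - b)⁺ := posPart_mono (sub_le_sub_left h _)

end VectorLattice

section DisjointSequences

variable {E : Type*} [NormedAddCommGroup E] [Lattice E]

lemma IsDisjointSeq.mono [IsOrderedAddMonoid E] {x y : ℕ → E} (hx : IsDisjointSeq x)
    (h : ∀ n, |y n| ≤ |x n|) : IsDisjointSeq y := fun m n hmn =>
  inf_eq_zero_of_le (abs_nonneg _) (abs_nonneg _) (h m) (h n) (hx m n hmn)

lemma isDisjointSeq_of_lt {x : ℕ → E} (h : ∀ m n, m < n → |x m| ⊓ |x n| = 0) :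
    IsDisjointSeq x := fun m n hmn =>
  hmn.lt_or_gt.elim (h m n) fun hnm => inf_comm |x m| |x n| ▸ h n m hnm

lemma mem_sol_of_abs_le {A : Set E} {x y : E} (hx : x ∈ sol A) (h : |y| ≤ |x|) : y ∈ sol A :=
  let ⟨a, ha, hxa⟩ := hx
  ⟨a, ha, h.trans hxa⟩

lemma mem_sol_singleton_of_nonneg [IsOrderedAddMonoid E] {x u : E} (hx : 0 ≤ x) (h : x ≤ u) :
    x ∈ sol {u} :=
  ⟨u, rfl, by rwa [abs_of_nonneg hx, abs_of_nonneg (hx.trans h)]⟩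

end DisjointSequences

section RieszSeminorm

variable {E : Type*} [NormedAddCommGroup E] [NormedSpace ℝ E] [Lattice E]

/-- Riesz (lattice) seminorms: seminorms that are monotone in the modulus. -/
def IsRieszSeminorm (p : Seminorm ℝ E) : Prop := ∀ ⦃x y : E⦄, |x| ≤ |y| → p x ≤ p y

/-- `p` tends to zero along every disjoint sequence of `A`. For `A = sol S` with `S` bounded and `p`
the norm, this is L-weak compactness of `S`. -/
def IsNullOnDisjointSeq (p : Seminorm ℝ E) (A : Set E) : Prop :=
  ∀ z : ℕ → E, IsDisjointSeq z → (∀ n, z n ∈ A) → Tendsto (fun n => p (z n)) atTop (𝓝 0)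

lemma IsNullOnDisjointSeq.mono {p : Seminorm ℝ E} {A B : Set E} (h : IsNullOnDisjointSeq p B)
    (hAB : A ⊆ B) : IsNullOnDisjointSeq p A :=
  fun z hz hzA => h z hz fun n => hAB (hzA n)

namespace IsRieszSeminorm

variable {p : Seminorm ℝ E}

lemma le_add_of_abs_le (hp : IsRieszSeminorm p) {x a b : E} (h : |x| ≤ a + b) :
    p x ≤ p a + p b :=
  (hp (h.trans (le_abs_self _))).trans (map_add_le_add p a b)

variable [IsOrderedAddMonoid E]

lemma le_of_nonneg_of_le (hp : IsRieszSeminorm p) {x y : E} (hx : 0 ≤ x) (h : x ≤ y) :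
    p x ≤ p y :=
  hp (by rwa [abs_of_nonneg hx, abs_of_nonneg (hx.trans h)])

lemma apply_abs (hp : IsRieszSeminorm p) (x : E) : p |x| = p x :=
  (hp (abs_abs x).le).antisymm (hp (abs_abs x).ge)

lemma le_apply_inf_add_apply_posPart_sub (hp : IsRieszSeminorm p) (x u : E) :
    p x ≤ p (|x| ⊓ u) + p (|x| - u)⁺ :=
  hp.le_add_of_abs_le (inf_add_posPart_sub |x| u).ge

end IsRieszSeminorm

end RieszSeminorm

section SolidSeminorm

variable {E : Type*} [NormedAddCommGroup E] [NormedSpace ℝ E] [Lattice E] [HasSolidNorm E]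
  {Y : Type*} [NormedAddCommGroup Y] [NormedSpace ℝ Y]

lemma norm_apply_le_of_abs_le (T : E →L[ℝ] Y) {x z : E} (h : |z| ≤ |x|) : ‖T z‖ ≤ ‖T‖ * ‖x‖ :=
  T.le_opNorm_of_le (norm_le_norm_of_abs_le_abs h)

lemma bddAbove_range_norm_apply (T : E →L[ℝ] Y) (x : E) :
    BddAbove (Set.range fun z : {z : E // |z| ≤ |x|} => ‖T z‖) :=
  ⟨‖T‖ * ‖x‖, Set.forall_mem_range.2 fun z => norm_apply_le_of_abs_le T z.2⟩

variable [IsOrderedAddMonoid E] [IsOrderedModule ℝ E]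

/-- The solid seminorm of `T`: the supremum of `‖T z‖` over `|z| ≤ |x|`. When `T` is a functional
it is, on the positive cone, the modulus `|T|` of Riesz and Kantorovich. -/
noncomputable def solidSeminorm (T : E →L[ℝ] Y) : Seminorm ℝ E :=
  Seminorm.ofSMulLE (fun x => ⨆ z : {z : E // |z| ≤ |x|}, ‖T z‖)
    (le_antisymm
      (Real.iSup_le (fun z => by simpa using norm_apply_le_of_abs_le T z.2) le_rfl)
      (Real.iSup_nonneg fun _ => norm_nonneg _))
    (fun x y => by
      have : Nonempty {z : E // |z| ≤ |x + y|} := ⟨⟨x + y, le_rfl⟩⟩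
      refine ciSup_le fun ⟨z, hz⟩ => ?_
      obtain ⟨z₁, z₂, rfl, h₁, h₂⟩ :=
        exists_add_of_abs_le_add (abs_nonneg x) (abs_nonneg y) (hz.trans (abs_add_le x y))
      rw [map_add]
      exact norm_add_le_of_le (le_ciSup (bddAbove_range_norm_apply T x) ⟨z₁, h₁⟩)
        (le_ciSup (bddAbove_range_norm_apply T y) ⟨z₂, h₂⟩))
    (fun r x => by
      rcases eq_or_ne r 0 with rfl | hr
      · rw [norm_zero, zero_mul]
        exact Real.iSup_le (fun z => by simpa using norm_apply_le_of_abs_le T z.2) le_rfl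
      have : Nonempty {z : E // |z| ≤ |r • x|} := ⟨⟨r • x, le_rfl⟩⟩
      refine ciSup_le fun ⟨z, hz⟩ => ?_
      have hz' : |r⁻¹ • z| ≤ |x| :=
        calc |r⁻¹ • z| ≤ |r|⁻¹ • |z| := abs_inv r ▸ abs_smul_le r⁻¹ z
          _ ≤ |r|⁻¹ • |r| • |x| := smul_le_smul_of_nonneg_left
              (hz.trans (abs_smul_le r x)) (inv_nonneg.2 (abs_nonneg r))
          _ = |x| := inv_smul_smul₀ (abs_ne_zero.2 hr) _
      calc ‖T z‖ = ‖r‖ * ‖T (r⁻¹ • z)‖ := by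
            rw [← norm_smul, ← map_smul, smul_inv_smul₀ hr]
        _ ≤ ‖r‖ * _ := mul_le_mul_of_nonneg_left
            (le_ciSup (bddAbove_range_norm_apply T x) ⟨_, hz'⟩) (norm_nonneg r))

lemma solidSeminorm_le (T : E →L[ℝ] Y) {x : E} {c : ℝ} (h : ∀ z, |z| ≤ |x| → ‖T z‖ ≤ c) :
    solidSeminorm T x ≤ c :=
  have : Nonempty {z : E // |z| ≤ |x|} := ⟨⟨x, le_rfl⟩⟩
  ciSup_le fun z => h z z.2

lemma norm_apply_le_solidSeminorm (T : E →L[ℝ] Y) {x z : E} (h : |z| ≤ |x|) :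
    ‖T z‖ ≤ solidSeminorm T x :=
  le_ciSup (bddAbove_range_norm_apply T x) ⟨z, h⟩

lemma isRieszSeminorm_solidSeminorm (T : E →L[ℝ] Y) : IsRieszSeminorm (solidSeminorm T) :=
  fun _ _ h => solidSeminorm_le T fun _ hz => norm_apply_le_solidSeminorm T (hz.trans h)

lemma continuous_solidSeminorm (T : E →L[ℝ] Y) : Continuous (solidSeminorm T) := by
  have hT : Continuous (‖T‖₊ • normSeminorm ℝ E) := continuous_norm.const_smul ‖T‖₊
  exact Seminorm.continuous_of_le hT fun x =>
    solidSeminorm_le T fun z hz => norm_apply_le_of_abs_le T hz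

lemma exists_solidSeminorm_le_two_mul_norm (T : E →L[ℝ] Y) (x : E) :
    ∃ z, |z| ≤ |x| ∧ solidSeminorm T x ≤ 2 * ‖T z‖ := by
  by_contra! h
  have hx : solidSeminorm T x ≤ solidSeminorm T x / 2 :=
    solidSeminorm_le T fun z hz => by linarith [h z hz]
  linarith [h x le_rfl, norm_nonneg (T x)]

lemma isNullOnDisjointSeq_solidSeminorm {T : E →L[ℝ] Y} {A : Set E}
    (hT : ∀ z : ℕ → E, IsDisjointSeq z → (∀ n, z n ∈ sol A) →
      Tendsto (fun n => T (z n)) atTop (𝓝 0)) :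
    IsNullOnDisjointSeq (solidSeminorm T) (sol A) := by
  intro w hw hwA
  choose z hz hwz using fun n => exists_solidSeminorm_le_two_mul_norm T (w n)
  have hTz := hT z (hw.mono hz) fun n => mem_sol_of_abs_le (hwA n) (hz n)
  exact squeeze_zero (fun n => apply_nonneg _ _) hwz (by simpa using hTz.norm.const_mul 2)

lemma solidSeminorm_add (g : E →L[ℝ] ℝ) {a b : E} (ha : 0 ≤ a) (hb : 0 ≤ b) :
    solidSeminorm g (a + b) = solidSeminorm g a + solidSeminorm g b := by
  refine le_antisymm (map_add_le_add _ a b) ?_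
  rw [← le_sub_iff_add_le]
  refine solidSeminorm_le g fun z hz => ?_
  rw [le_sub_comm]
  refine solidSeminorm_le g fun w hw => ?_
  rw [le_sub_iff_add_le']
  rw [abs_of_nonneg ha] at hz
  rw [abs_of_nonneg hb] at hw
  have key {w : E} (hw : |w| ≤ b) : |g z + g w| ≤ solidSeminorm g (a + b) := by
    rw [← map_add, ← Real.norm_eq_abs]
    refine norm_apply_le_solidSeminorm g ?_
    rw [abs_of_nonneg (add_nonneg ha hb)]
    exact (abs_add_le z w).trans (add_le_add hz hw)
  have h₁ := abs_le.1 (key hw)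
  have h₂ := abs_le.1 (key (w := -w) (by rwa [abs_neg]))
  rw [map_neg] at h₂
  rw [Real.norm_eq_abs, Real.norm_eq_abs, ← le_sub_iff_add_le]
  refine abs_le'.2 ⟨le_sub_comm.1 (abs_le'.2 ⟨?_, ?_⟩), le_sub_comm.1 (abs_le'.2 ⟨?_, ?_⟩)⟩ <;>
    linarith

end SolidSeminorm

section HahnBanach

variable {E : Type*} [NormedAddCommGroup E] [NormedSpace ℝ E]

lemma exists_continuousLinearMap_eq_of_sublinear {N : E → ℝ} {C : ℝ}
    (hN : ∀ c : ℝ, 0 < c → ∀ v, N (c • v) = c * N v) (hadd : ∀ v w, N (v + w) ≤ N v + N w)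
    (hC : ∀ v, N v ≤ C * ‖v‖) (y : E) :
    ∃ g : E →L[ℝ] ℝ, g y = N y ∧ ∀ v, g v ≤ N v := by
  have hN0 : N 0 = 0 := by linarith [smul_zero (A := E) (2 : ℝ) ▸ hN 2 two_pos 0]
  have hker (c : ℝ) (hc : c • y = 0) : RingHom.id ℝ c • N y = 0 := by
    rcases smul_eq_zero.1 hc with rfl | rfl
    · exact zero_smul ℝ _
    · rw [hN0, smul_zero]
  have hspan (c : ℝ) : c • N y ≤ N (c • y) := by
    rcases lt_trichotomy c 0 with hc | rfl | hc
    · have h := hadd (c • y) (-c • y)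
      rw [← add_smul, add_neg_cancel, zero_smul, hN0, hN (-c) (neg_pos.2 hc)] at h
      rw [smul_eq_mul]
      linarith
    · rw [zero_smul, zero_smul, hN0]
    · exact (hN c hc y).ge
  obtain ⟨g, hg, hgN⟩ := exists_extension_of_le_sublinear
    (LinearPMap.mkSpanSingleton' y (N y) hker) N hN hadd (by
      rintro ⟨v, hv⟩
      obtain ⟨c, rfl⟩ := Submodule.mem_span_singleton.1 hv
      rw [LinearPMap.mkSpanSingleton'_apply]
      exact hspan c)
  have hbound (v : E) : ‖g v‖ ≤ C * ‖v‖ :=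
    abs_le'.2 ⟨(hgN v).trans (hC v), by simpa using (hgN (-v)).trans (hC (-v))⟩
  have hy : y ∈ (LinearPMap.mkSpanSingleton' y (N y) hker).domain :=
    Submodule.mem_span_singleton_self y
  exact ⟨g.mkContinuous C hbound,
    (hg ⟨y, hy⟩).trans (LinearPMap.mkSpanSingleton'_apply_self _ _ _ hy), hgN⟩

lemma exists_continuousLinearMap_eq_of_seminorm {q : Seminorm ℝ E} (hq : Continuous q) (y : E) :
    ∃ g : E →L[ℝ] ℝ, g y = q y ∧ ∀ v, |g v| ≤ q v := by
  obtain ⟨C, -, hC⟩ := q.bound_of_continuous_normedSpace hq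
  obtain ⟨g, hgy, hgq⟩ := exists_continuousLinearMap_eq_of_sublinear
    (fun c hc v => by rw [map_smul_eq_mul, Real.norm_of_nonneg hc.le]) (map_add_le_add q) hC y
  exact ⟨g, hgy, fun v => abs_le'.2 ⟨hgq v, by simpa using hgq (-v)⟩⟩

lemma IsRieszSeminorm.exists_monotone_eq [Lattice E] [IsOrderedAddMonoid E] [IsOrderedModule ℝ E]
    {p : Seminorm ℝ E} (hp : IsRieszSeminorm p) (hpc : Continuous p) {x : E} (hx : 0 ≤ x) :
    ∃ F : E →L[ℝ] ℝ, Monotone F ∧ F x = p x ∧ ∀ y, 0 ≤ y → F y ≤ p y := by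
  obtain ⟨C, -, hC⟩ := p.bound_of_continuous_normedSpace hpc
  have hpos (v : E) : p v⁺ ≤ p v := by
    refine hp ?_
    rw [abs_of_nonneg (posPart_nonneg v)]
    exact sup_le (le_abs_self v) (abs_nonneg v)
  obtain ⟨F, hFx, hFp⟩ := exists_continuousLinearMap_eq_of_sublinear (N := fun v => p v⁺)
    (fun c hc v => by rw [posPart_smul_of_nonneg hc.le, map_smul_eq_mul, Real.norm_of_nonneg hc.le])
    (fun v w => (hp.le_of_nonneg_of_le (posPart_nonneg _) (posPart_add_le v w)).trans
      (map_add_le_add p _ _))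
    (fun v => (hpos v).trans (hC v)) x
  have hF_nonneg (y : E) (hy : 0 ≤ y) : 0 ≤ F y := by
    simpa [posPart_eq_zero.2 (neg_nonpos.2 hy)] using hFp (-y)
  refine ⟨F, fun a b hab => ?_, by rw [hFx, posPart_of_nonneg hx], fun y hy => ?_⟩
  · exact sub_nonneg.1 (map_sub F b a ▸ hF_nonneg _ (sub_nonneg.2 hab))
  · simpa only [posPart_of_nonneg hy] using hFp y

end HahnBanach

section Schur

lemma norm_mul_le_of_abs_le_one {t : ℝ} (ht : |t| ≤ 1) (r : ℝ) : ‖t * r‖ ≤ |r| := by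
  rw [norm_mul]
  exact mul_le_of_le_one_left (abs_nonneg r) ht

lemma exists_eqOn_tsum_abs_le {a : ℕ → ℝ} (ha : Summable fun j => |a j|)
    (τ₀ : ℕ → Set.Icc (-1 : ℝ) 1) (I : Finset ℕ) :
    ∃ τ : ℕ → Set.Icc (-1 : ℝ) 1, Set.EqOn τ τ₀ I ∧
      ∑' j, |a j| ≤ |∑' j, (τ j : ℝ) * a j| + ∑ j ∈ I, 2 * |a j| := by
  let sgn (j : ℕ) : Set.Icc (-1 : ℝ) 1 := ⟨SignType.sign (a j), by
    rcases SignType.trichotomy (SignType.sign (a j)) with h | h | h <;> simp [h]⟩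
  let τ (j : ℕ) := if j ∈ I then τ₀ j else sgn j
  refine ⟨τ, fun j hj => if_pos hj, ?_⟩
  have hle (j : ℕ) : |a j| ≤ τ j * a j + if j ∈ I then 2 * |a j| else 0 := by
    by_cases hj : j ∈ I
    · have h := abs_le.1 (norm_mul_le_of_abs_le_one (abs_le.2 (τ₀ j).2) (a j))
      simp only [τ, if_pos hj]
      linarith
    · simp only [τ, sgn, if_neg hj, sign_mul_self, add_zero, le_refl]
  have hτ : Summable fun j => (τ j : ℝ) * a j :=
    Summable.of_norm_bounded ha fun j => norm_mul_le_of_abs_le_one (abs_le.2 (τ j).2) (a j)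
  have hI : HasSum (fun j => if j ∈ I then 2 * |a j| else 0) (∑ j ∈ I, 2 * |a j|) := by
    rw [← Finset.sum_congr rfl fun j (hj : j ∈ I) => if_pos hj]
    exact hasSum_sum_of_ne_finset_zero fun j hj => if_neg hj
  exact (hasSum_le hle ha.hasSum (hτ.hasSum.add hI)).trans (add_le_add_left (le_abs_self _) _)

variable {a : ℕ → ℕ → ℝ}

lemma exists_nonempty_interior_forall_abs_tsum_le (ha : ∀ n, Summable fun j => |a n j|)
    (h : ∀ τ : ℕ → ℝ, (∀ j, |τ j| ≤ 1) → Tendsto (fun n => ∑' j, τ j * a n j) atTop (𝓝 0))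
    {ε : ℝ} (hε : 0 < ε) :
    ∃ N, (interior {τ : ℕ → Set.Icc (-1 : ℝ) 1 |
      ∀ n ≥ N, |∑' j, (τ j : ℝ) * a n j| ≤ ε}).Nonempty := by
  have : Nonempty (Set.Icc (-1 : ℝ) 1) := ⟨⟨0, by norm_num⟩⟩
  refine nonempty_interior_of_iUnion_of_closed (fun N => ?_) ?_
  · simp only [Set.ofPred_forall]
    refine isClosed_iInter fun n => isClosed_iInter fun _ => ?_
    have hcont : Continuous fun τ : ℕ → Set.Icc (-1 : ℝ) 1 => ∑' j, (τ j : ℝ) * a n j := by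
      refine continuous_tsum (fun j => by fun_prop) (ha n) fun j τ => ?_
      exact norm_mul_le_of_abs_le_one (abs_le.2 (τ j).2) _
    exact isClosed_le hcont.abs continuous_const
  · refine Set.eq_univ_of_forall fun τ => Set.mem_iUnion.2 ?_
    have hτ := (h (fun j => τ j) fun j => abs_le.2 (τ j).2).abs
    rw [abs_zero] at hτ
    exact eventually_atTop.1 (hτ.eventually_le_const hε)

/-- The Schur property of `ℓ¹`. -/
lemma tendsto_tsum_abs_of_forall_tendsto_tsum_mul (ha : ∀ n, Summable fun j => |a n j|)
    (h : ∀ τ : ℕ → ℝ, (∀ j, |τ j| ≤ 1) → Tendsto (fun n => ∑' j, τ j * a n j) atTop (𝓝 0)) :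
    Tendsto (fun n => ∑' j, |a n j|) atTop (𝓝 0) := by
  have hcoord (j : ℕ) : Tendsto (fun n => |a n j|) atTop (𝓝 0) := by
    have hj := (h (Pi.single j 1) fun k => by
      rcases eq_or_ne k j with rfl | hk <;> simp [*]).abs
    simpa [Pi.single_apply] using hj
  rw [Metric.tendsto_atTop]
  intro ε hε
  obtain ⟨N, τ₀, hτ₀⟩ := exists_nonempty_interior_forall_abs_tsum_le ha h (half_pos hε)
  obtain ⟨I, V, hV, hVF⟩ := isOpen_pi_iff.1 isOpen_interior τ₀ hτ₀
  have hI : Tendsto (fun n => ∑ j ∈ I, 2 * |a n j|) atTop (𝓝 0) := by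
    simpa using tendsto_finsetSum I fun j _ => (hcoord j).const_mul 2
  obtain ⟨N', hN'⟩ := eventually_atTop.1 (hI.eventually_lt_const (half_pos hε))
  refine ⟨max N N', fun n hn => ?_⟩
  obtain ⟨τ, hττ₀, hτ⟩ := exists_eqOn_tsum_abs_le (ha n) τ₀ I
  have hτε : |∑' j, (τ j : ℝ) * a n j| ≤ ε / 2 :=
    interior_subset (hVF fun j hj => (hττ₀ hj).symm ▸ (hV j hj).2) n (le_of_max_le_left hn)
  rw [Real.dist_eq, sub_zero, abs_of_nonneg (tsum_nonneg fun j => abs_nonneg _)]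
  linarith [hN' n (le_of_max_le_right hn)]

end Schur

section WeakTopology

variable {E : Type*} [NormedAddCommGroup E] [NormedSpace ℝ E]

lemma tendsto_toWeakSpace_iff {ι : Type*} {l : Filter ι} {x : ι → E} {a : E} :
    Tendsto (fun i => toWeakSpace ℝ E (x i)) l (𝓝 (toWeakSpace ℝ E a)) ↔
      ∀ f : E →L[ℝ] ℝ, Tendsto (fun i => f (x i)) l (𝓝 (f a)) :=
  WeakBilin.tendsto_iff_forall_eval_tendsto (topDualPairing ℝ E).flip fun _ _ h => by
    by_contra hne
    obtain ⟨f, hf⟩ := SeparatingDual.exists_separating_of_ne (R := ℝ) hne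
    exact hf (DFunLike.congr_fun h f)

lemma continuous_apply_toWeakSpace_symm (f : E →L[ℝ] ℝ) :
    Continuous fun w : WeakSpace ℝ E => f ((toWeakSpace ℝ E).symm w) :=
  WeakBilin.eval_continuous (topDualPairing ℝ E).flip f

lemma isRelativelyWeaklyCompact_singleton (x : E) : IsRelativelyWeaklyCompact {x} := by
  rw [IsRelativelyWeaklyCompact, Set.image_singleton, closure_singleton]
  exact isCompact_singleton

lemma isRelativelyWeaklyCompact_range_of_tendsto {x : ℕ → E} {a : E}
    (hx : Tendsto (fun n => toWeakSpace ℝ E (x n)) atTop (𝓝 (toWeakSpace ℝ E a))) :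
    IsRelativelyWeaklyCompact (Set.range x) := by
  refine hx.isCompact_insert_range.closure_of_subset ?_
  rw [← Set.range_comp]
  exact Set.subset_insert _ _

namespace IsRelativelyWeaklyCompact

variable {S : Set E}

lemma exists_norm_le (hS : IsRelativelyWeaklyCompact S) : ∃ C, ∀ x ∈ S, ‖x‖ ≤ C := by
  have hb (f : E →L[ℝ] ℝ) : ∃ C, ∀ x : S, ‖NormedSpace.inclusionInDoubleDual ℝ E x f‖ ≤ C := by
    obtain ⟨C, hC⟩ := (hS.image (continuous_apply_toWeakSpace_symm f)).isBounded.exists_norm_le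
    exact ⟨C, fun x => hC _ ⟨toWeakSpace ℝ E x, subset_closure ⟨x, x.2, rfl⟩, rfl⟩⟩
  obtain ⟨C, hC⟩ := banach_steinhaus hb
  refine ⟨C, fun x hx => ?_⟩
  rw [← (NormedSpace.inclusionInDoubleDualLi ℝ (E := E)).norm_map x]
  exact hC ⟨x, hx⟩

lemma exists_tendsto_ultrafilter (hS : IsRelativelyWeaklyCompact S) {ι : Type*}
    (U : Ultrafilter ι) {y : ι → E} (hy : ∀ i, y i ∈ S) :
    ∃ b, ∀ f : E →L[ℝ] ℝ, Tendsto (fun i => f (y i)) U (𝓝 (f b)) := by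
  have hU : ∀ᶠ i in U, toWeakSpace ℝ E (y i) ∈ closure (toWeakSpace ℝ E '' S) :=
    .of_forall fun i => subset_closure ⟨y i, hy i, rfl⟩
  obtain ⟨a, -, ha⟩ :=
    hS.ultrafilter_le_nhds (U.map fun i => toWeakSpace ℝ E (y i)) (le_principal_iff.2 hU)
  obtain ⟨b, rfl⟩ := (toWeakSpace ℝ E).surjective a
  exact ⟨b, tendsto_toWeakSpace_iff.1 ha⟩

lemma exists_subseq_tendsto_apply (hS : IsRelativelyWeaklyCompact S) (g : ℕ → E →L[ℝ] ℝ)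
    {y : ℕ → E} (hy : ∀ n, y n ∈ S) :
    ∃ φ : ℕ → ℕ, StrictMono φ ∧
      ∃ b, ∀ j, Tendsto (fun k => g j (y (φ k))) atTop (𝓝 (g j b)) := by
  have hcont : Continuous fun (w : WeakSpace ℝ E) j => g j ((toWeakSpace ℝ E).symm w) :=
    continuous_pi fun j => continuous_apply_toWeakSpace_symm (g j)
  obtain ⟨_, ⟨w, -, rfl⟩, φ, hφ, hlim⟩ := (hS.image hcont).tendsto_subseq
    (x := fun n j => g j (y n)) fun n => ⟨_, subset_closure ⟨y n, hy n, rfl⟩, rfl⟩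
  exact ⟨φ, hφ, (toWeakSpace ℝ E).symm w, tendsto_pi_nhds.1 hlim⟩

lemma tendsto_apply_of_separating (hS : IsRelativelyWeaklyCompact S) {ι κ : Type*} {l : Filter ι}
    {g : κ → E →L[ℝ] ℝ} {y : ι → E} (hy : ∀ i, y i ∈ S) {b : E}
    (hb : ∀ j, Tendsto (fun i => g j (y i)) l (𝓝 (g j b))) {G : E →L[ℝ] ℝ}
    (hG : ∀ v w, (∀ j, g j v = g j w) → G v = G w) :
    Tendsto (fun i => G (y i)) l (𝓝 (G b)) := by
  refine tendsto_iff_ultrafilter _ _ _ |>.2 fun U hU => ?_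
  obtain ⟨c, hc⟩ := hS.exists_tendsto_ultrafilter U hy
  have hcb : G c = G b := hG c b fun j => tendsto_nhds_unique (hc (g j)) ((hb j).mono_left hU)
  exact hcb ▸ hc G

end IsRelativelyWeaklyCompact

lemma exists_continuousLinearMap_eq_tsum {g : ℕ → E →L[ℝ] ℝ} {C : ℝ}
    (hg : ∀ v (s : Finset ℕ), ∑ n ∈ s, |g n v| ≤ C * ‖v‖) {τ : ℕ → ℝ} (hτ : ∀ j, |τ j| ≤ 1) :
    ∃ G : E →L[ℝ] ℝ, ∀ v, G v = ∑' j, τ j * g j v := by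
  have hsum (v : E) : Summable fun n => |g n v| :=
    summable_of_sum_le (fun _ => abs_nonneg _) (hg v)
  have hτg (v : E) (j : ℕ) : ‖τ j * g j v‖ ≤ |g j v| := norm_mul_le_of_abs_le_one (hτ j) _
  have hsumτ (v : E) : Summable fun j => τ j * g j v := .of_norm_bounded (hsum v) (hτg v)
  let G : E →ₗ[ℝ] ℝ :=
    { toFun := fun v => ∑' j, τ j * g j v
      map_add' := fun v w => by
        simp only [map_add, mul_add]
        exact (hsumτ v).tsum_add (hsumτ w)
      map_smul' := fun r v => by
        simp only [map_smul, smul_eq_mul, mul_left_comm _ r, RingHom.id_apply]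
        exact tsum_mul_left }
  refine ⟨G.mkContinuous C fun v => ?_, fun _ => rfl⟩
  exact (tsum_of_norm_bounded (hsum v).hasSum (hτg v)).trans ((hsum v).tsum_le_of_sum_le (hg v))

lemma IsRelativelyWeaklyCompact.tendsto_apply_of_sum_abs_le {S : Set E}
    (hS : IsRelativelyWeaklyCompact S) {g : ℕ → E →L[ℝ] ℝ} {C : ℝ}
    (hg : ∀ v (s : Finset ℕ), ∑ n ∈ s, |g n v| ≤ C * ‖v‖) {y : ℕ → E} (hy : ∀ n, y n ∈ S) :
    Tendsto (fun n => g n (y n)) atTop (𝓝 0) := by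
  have hsum (v : E) : Summable fun n => |g n v| :=
    summable_of_sum_le (fun _ => abs_nonneg _) (hg v)
  refine tendsto_of_subseq_tendsto fun ns hns => ?_
  obtain ⟨φ, hφ, b, hb⟩ := hS.exists_subseq_tendsto_apply g fun n => hy (ns n)
  have hsigns (τ : ℕ → ℝ) (hτ : ∀ j, |τ j| ≤ 1) :
      Tendsto (fun k => ∑' j, τ j * g j (y (ns (φ k)) - b)) atTop (𝓝 0) := by
    obtain ⟨G, hG⟩ := exists_continuousLinearMap_eq_tsum hg hτ
    have hGb := hS.tendsto_apply_of_separating (G := G) (fun k => hy (ns (φ k))) hb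
      fun v w h => by simp only [hG, h]
    simp only [← hG]
    simpa only [map_sub] using tendsto_sub_nhds_zero_iff.2 hGb
  have hschur := tendsto_tsum_abs_of_forall_tendsto_tsum_mul (fun k => hsum _) hsigns
  have hgb : Tendsto (fun k => |g (ns (φ k)) b|) atTop (𝓝 0) :=
    (hsum b).tendsto_atTop_zero.comp (hns.comp hφ.tendsto_atTop)
  refine ⟨φ, squeeze_zero_norm (fun k => ?_) (add_zero (0 : ℝ) ▸ hschur.add hgb)⟩
  calc ‖g (ns (φ k)) (y (ns (φ k)))‖
      ≤ |g (ns (φ k)) (y (ns (φ k)) - b)| + |g (ns (φ k)) b| := by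
        simpa using abs_add_le (g (ns (φ k)) (y (ns (φ k)) - b)) (g (ns (φ k)) b)
    _ ≤ _ := add_le_add_left ((hsum _).le_tsum _ fun _ _ => abs_nonneg _) _

end WeakTopology

section Carrier

variable {E : Type*} [NormedAddCommGroup E] [NormedSpace ℝ E] [Lattice E]
  [IsOrderedAddMonoid E] {p : Seminorm ℝ E}

lemma IsRieszSeminorm.bddAbove_range_inf_nsmul (hp : IsRieszSeminorm p) (e y : E) :
    BddAbove (Set.range fun k : ℕ => p (|y| ⊓ k • |e|)) :=
  ⟨p |y|, Set.forall_mem_range.2 fun k => hp.le_of_nonneg_of_le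
    (le_inf (abs_nonneg y) (nsmul_nonneg (abs_nonneg e) k)) inf_le_left⟩

lemma exists_abs_smul_inf_nsmul_le [IsOrderedModule ℝ E] {r : ℝ} (hr : r ≠ 0) {e : E}
    (he : 0 ≤ e) (y : E) (k : ℕ) : ∃ m : ℕ, |r • y| ⊓ k • e ≤ |r| • (|y| ⊓ m • e) := by
  have hr' : 0 < |r| := abs_pos.2 hr
  obtain ⟨m, hm⟩ := exists_nat_ge (k / |r|)
  have hkm : k • e ≤ |r| • m • e := by
    rw [← Nat.cast_smul_eq_nsmul ℝ, ← Nat.cast_smul_eq_nsmul ℝ, smul_smul, mul_comm]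
    exact smul_le_smul_of_nonneg_right ((div_le_iff₀ hr').1 hm) he
  exact ⟨m, (inf_le_inf (abs_smul_le r y) hkm).trans_eq
    (map_inf (OrderIso.smulRight hr') |y| (m • e)).symm⟩

variable [IsOrderedModule ℝ E]

/-- The part of the Riesz seminorm `p` carried by the principal band generated by `e`. -/
noncomputable def carrierSeminorm (hp : IsRieszSeminorm p) (e : E) : Seminorm ℝ E :=
  Seminorm.ofSMulLE (fun y => ⨆ k : ℕ, p (|y| ⊓ k • |e|))
    (by
      have h (k : ℕ) : |(0 : E)| ⊓ k • |e| = 0 := by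
        rw [abs_zero]
        exact inf_eq_left.2 (nsmul_nonneg (abs_nonneg e) k)
      simp only [h, map_zero, ciSup_const])
    (fun y z => ciSup_le fun k => by
      have hk := nsmul_nonneg (abs_nonneg e) k
      calc p (|y + z| ⊓ k • |e|) ≤ p (|y| ⊓ k • |e| + |z| ⊓ k • |e|) :=
            hp.le_of_nonneg_of_le (le_inf (abs_nonneg _) hk) <|
              (inf_le_inf_right _ (abs_add_le y z)).trans
                (add_inf_le_inf_add_inf (abs_nonneg y) (abs_nonneg z) hk)
        _ ≤ _ := (map_add_le_add p _ _).trans (add_le_add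
            (le_ciSup (hp.bddAbove_range_inf_nsmul e y) k)
            (le_ciSup (hp.bddAbove_range_inf_nsmul e z) k)))
    (fun r y => ciSup_le fun k => by
      have hk := nsmul_nonneg (abs_nonneg e) k
      rcases eq_or_ne r 0 with rfl | hr
      · rw [zero_smul, abs_zero, inf_eq_left.2 hk, map_zero, norm_zero, zero_mul]
      obtain ⟨m, hm⟩ := exists_abs_smul_inf_nsmul_le hr (abs_nonneg e) y k
      calc p (|r • y| ⊓ k • |e|) ≤ p (|r| • (|y| ⊓ m • |e|)) :=
            hp.le_of_nonneg_of_le (le_inf (abs_nonneg _) hk) hm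
        _ = ‖r‖ * p (|y| ⊓ m • |e|) := by rw [map_smul_eq_mul, Real.norm_eq_abs, abs_abs]; rfl
        _ ≤ _ := mul_le_mul_of_nonneg_left
            (le_ciSup (hp.bddAbove_range_inf_nsmul e y) m) (norm_nonneg r))

namespace IsRieszSeminorm

lemma carrierSeminorm_le (hp : IsRieszSeminorm p) (e y : E) : carrierSeminorm hp e y ≤ p y :=
  ciSup_le fun k => (hp.le_of_nonneg_of_le (le_inf (abs_nonneg y)
    (nsmul_nonneg (abs_nonneg e) k)) inf_le_left).trans_eq (hp.apply_abs y)

lemma le_carrierSeminorm (hp : IsRieszSeminorm p) {x y : E} (h : |x| ≤ |y|) :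
    p x ≤ carrierSeminorm hp x y := by
  refine le_of_eq_of_le ?_ (le_ciSup (hp.bddAbove_range_inf_nsmul x y) 1)
  rw [one_nsmul, inf_eq_right.2 h, hp.apply_abs]

lemma tendsto_carrierSeminorm (hp : IsRieszSeminorm p) (e y : E) :
    Tendsto (fun k : ℕ => p (|y| ⊓ k • |e|)) atTop (𝓝 (carrierSeminorm hp e y)) :=
  tendsto_atTop_ciSup (fun i _ hij => hp.le_of_nonneg_of_le
    (le_inf (abs_nonneg y) (nsmul_nonneg (abs_nonneg e) i))
    (inf_le_inf_left _ (nsmul_le_nsmul_left (abs_nonneg e) hij))) (hp.bddAbove_range_inf_nsmul e y)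

lemma sum_carrierSeminorm_le (hp : IsRieszSeminorm p)
    (hadd : ∀ ⦃a b : E⦄, 0 ≤ a → 0 ≤ b → p (a + b) = p a + p b)
    {e : ℕ → E} (he : IsDisjointSeq e) (y : E) (s : Finset ℕ) :
    ∑ n ∈ s, carrierSeminorm hp (e n) y ≤ p y := by
  classical
  refine le_of_tendsto' (tendsto_finsetSum s fun n _ => hp.tendsto_carrierSeminorm (e n) y)
    fun k => ?_
  have hnn (n : ℕ) : 0 ≤ |y| ⊓ k • |e n| :=
    le_inf (abs_nonneg y) (nsmul_nonneg (abs_nonneg _) k)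
  have hsum (s : Finset ℕ) :
      ∑ n ∈ s, p (|y| ⊓ k • |e n|) = p (∑ n ∈ s, |y| ⊓ k • |e n|) := by
    induction s using Finset.induction_on with
    | empty => simp only [Finset.sum_empty, map_zero]
    | insert n s hn ih =>
      rw [Finset.sum_insert hn, Finset.sum_insert hn, ih,
        hadd (hnn n) (Finset.sum_nonneg fun m _ => hnn m)]
  have hdisj (m n : ℕ) (hmn : m ≠ n) : (|y| ⊓ k • |e m|) ⊓ (|y| ⊓ k • |e n|) = 0 :=
    inf_eq_zero_of_le (hnn m) (hnn n) inf_le_right inf_le_right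
      (nsmul_inf_nsmul_eq_zero (abs_nonneg _) (abs_nonneg _) (he m n hmn) k)
  rw [hsum, ← hp.apply_abs y]
  exact hp.le_of_nonneg_of_le (Finset.sum_nonneg fun n _ => hnn n)
    (sum_le_of_pairwise_disjoint (abs_nonneg y) hnn (fun _ => inf_le_left) hdisj s)

end IsRieszSeminorm

lemma IsRelativelyWeaklyCompact.tendsto_of_isDisjointSeq [HasSolidNorm E] {S : Set E}
    (hS : IsRelativelyWeaklyCompact S) {x : ℕ → E} (hx : IsDisjointSeq x)
    (hxS : ∀ n, x n ∈ sol S) (f : E →L[ℝ] ℝ) : Tendsto (fun n => f (x n)) atTop (𝓝 0) := by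
  choose y hyS hxy using hxS
  have hp := isRieszSeminorm_solidSeminorm f
  have hpc := continuous_solidSeminorm f
  obtain ⟨C, -, hC⟩ := (solidSeminorm f).bound_of_continuous_normedSpace hpc
  choose g hgy hg using fun n => exists_continuousLinearMap_eq_of_seminorm
    (Seminorm.continuous_of_le hpc (hp.carrierSeminorm_le (x n))) (y n)
  have hsum (v : E) (s : Finset ℕ) : ∑ n ∈ s, |g n v| ≤ C * ‖v‖ :=
    calc ∑ n ∈ s, |g n v| ≤ ∑ n ∈ s, carrierSeminorm hp (x n) v :=
          Finset.sum_le_sum fun n _ => hg n v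
      _ ≤ solidSeminorm f v :=
          hp.sum_carrierSeminorm_le (fun a b ha hb => solidSeminorm_add f ha hb) hx v s
      _ ≤ C * ‖v‖ := hC v
  refine squeeze_zero_norm (fun n => ?_) (hS.tendsto_apply_of_sum_abs_le hsum hyS)
  calc ‖f (x n)‖ ≤ solidSeminorm f (x n) := norm_apply_le_solidSeminorm f le_rfl
    _ ≤ carrierSeminorm hp (x n) (y n) := hp.le_carrierSeminorm (hxy n)
    _ = g n (y n) := (hgy n).symm

end Carrier

section OrderInterval

variable {E : Type*} [NormedAddCommGroup E] [NormedSpace ℝ E] [Lattice E]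
  [IsOrderedAddMonoid E] {p : Seminorm ℝ E} {u : E}

lemma IsNullOnDisjointSeq.tendsto_layer (hpu : IsNullOnDisjointSeq p (sol {u})) (hu : 0 ≤ u)
    {v : ℕ → E} (hv : Monotone v) (hvu : ∀ n, v n ≤ u) {s t : E} (hs : 0 ≤ s) (hts : t ≤ s) :
    Tendsto (fun n => p ((v (n + 1) - s)⁺ ⊓ (t - v n)⁺)) atTop (𝓝 0) := by
  have hnn (n : ℕ) : 0 ≤ (v (n + 1) - s)⁺ ⊓ (t - v n)⁺ :=
    le_inf (posPart_nonneg _) (posPart_nonneg _)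
  refine hpu _ (isDisjointSeq_of_lt fun m n hmn => ?_) fun n => ?_
  · rw [abs_of_nonneg (hnn m), abs_of_nonneg (hnn n)]
    refine inf_eq_zero_of_le (hnn m) (hnn n) inf_le_left (inf_le_right.trans ?_)
      (posPart_inf_posPart_sub_eq_zero (v (m + 1)) s)
    exact posPart_mono (sub_le_sub hts (hv hmn))
  · refine mem_sol_singleton_of_nonneg (hnn n) (inf_le_left.trans (sup_le ?_ hu))
    exact (sub_le_self _ hs).trans (hvu _)

namespace IsRieszSeminorm

variable [IsOrderedModule ℝ E]

lemma tendsto_sub_succ_of_monotone (hp : IsRieszSeminorm p) (hpu : IsNullOnDisjointSeq p (sol {u}))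
    {v : ℕ → E} (hv : Monotone v) (hv0 : ∀ n, 0 ≤ v n) (hvu : ∀ n, v n ≤ u) :
    Tendsto (fun n => p (v (n + 1) - v n)) atTop (𝓝 0) := by
  have hu : 0 ≤ u := (hv0 0).trans (hvu 0)
  rw [tendsto_order]
  refine ⟨fun a ha => .of_forall fun n => ha.trans_le (apply_nonneg p _), fun ε hε => ?_⟩
  obtain ⟨J, hJ⟩ := exists_nat_gt (2 * p u / (ε / 2))
  have hJ0 : 0 < (J : ℝ) := lt_of_le_of_lt (by positivity) hJ
  let e : E := (J : ℝ)⁻¹ • u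
  have he : 0 ≤ e := smul_nonneg (inv_nonneg.2 hJ0.le) hu
  have hJe : J • e = u := by
    rw [← Nat.cast_smul_eq_nsmul ℝ, smul_inv_smul₀ hJ0.ne']
  have hpe : p (2 • e) < ε / 2 := by
    rw [← Nat.cast_smul_eq_nsmul ℝ, map_smul_eq_mul, map_smul_eq_mul, norm_inv,
      Real.norm_of_nonneg hJ0.le, Real.norm_of_nonneg (Nat.cast_nonneg 2)]
    rw [div_lt_iff₀ (half_pos hε)] at hJ
    rw [← div_eq_inv_mul, mul_div_assoc', div_lt_iff₀ hJ0, mul_comm (ε / 2)]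
    exact_mod_cast hJ
  let w (n j : ℕ) : E := (v (n + 1) - (j + 1) • e)⁺ ⊓ (j • e - v n)⁺
  have hw : Tendsto (fun n => ∑ j ∈ Finset.range J, p (w n j)) atTop (𝓝 0) := by
    simpa using tendsto_finsetSum (Finset.range J) fun j _ =>
      hpu.tendsto_layer hu hv hvu (nsmul_nonneg he (j + 1)) (nsmul_le_nsmul_left he j.le_succ)
  filter_upwards [hw.eventually_lt_const (half_pos hε)] with n hn
  have hlayers : v (n + 1) - v n ≤ ∑ j ∈ Finset.range J, w n j + 2 • e :=
    sub_le_iff_le_add.1 ((le_posPart _).trans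
      (posPart_sub_le_sum_layers he (hv0 n) ((hvu (n + 1)).trans hJe.ge)))
  calc p (v (n + 1) - v n) ≤ p (∑ j ∈ Finset.range J, w n j + 2 • e) :=
        hp.le_of_nonneg_of_le (sub_nonneg.2 (hv n.le_succ)) hlayers
    _ ≤ ∑ j ∈ Finset.range J, p (w n j) + p (2 • e) := (map_add_le_add p _ _).trans
        (add_le_add_left (Finset.le_sum_of_subadditive p (map_zero p).le (map_add_le_add p) _ _) _)
    _ < ε := by linarith

lemma exists_forall_apply_sub_le_of_monotone (hp : IsRieszSeminorm p)
    (hpu : IsNullOnDisjointSeq p (sol {u})) {v : ℕ → E} (hv : Monotone v)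
    (hv0 : ∀ n, 0 ≤ v n) (hvu : ∀ n, v n ≤ u) {ε : ℝ} (hε : 0 < ε) :
    ∃ N, ∀ n ≥ N, p (v n - v N) ≤ ε := by
  by_contra! h
  choose φ hφ hφε using h
  let k (n : ℕ) : ℕ := φ^[n] 0
  have hk : Monotone k := monotone_nat_of_le_succ fun n => by
    simpa only [k, Function.iterate_succ_apply'] using hφ _
  have hlim := hp.tendsto_sub_succ_of_monotone hpu (hv.comp hk) (fun n => hv0 _) fun n => hvu _
  refine hε.not_ge (ge_of_tendsto' hlim fun n => ?_)
  simpa only [k, Function.comp_apply, Function.iterate_succ_apply'] using (hφε (k n)).le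

/-- `s` is the running infimum of almost maximal partial sums
`u ⊓ (y j + ⋯ + y (m - 1))`, `j ≤ n`. -/
lemma exists_antitone_approx (hp : IsRieszSeminorm p) (hpu : IsNullOnDisjointSeq p (sol {u}))
    {y : ℕ → E} (hy : ∀ n, 0 ≤ y n) (hyu : ∀ n, y n ≤ u) {δ : ℝ} (hδ : 0 < δ) :
    ∃ s : ℕ → E, Antitone s ∧ (∀ n, 0 ≤ s n) ∧ (∀ n, s n ≤ u) ∧
      (∀ n, ∃ m, s n ≤ ∑ k ∈ Finset.Ico n m, y k) ∧ ∀ n, p (y n - s n)⁺ ≤ δ := by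
  have hu : 0 ≤ u := (hy 0).trans (hyu 0)
  obtain ⟨η, hη, c, hηc, hcδ⟩ := posSumOfEncodable hδ ℕ
  let w (j m : ℕ) : E := u ⊓ ∑ k ∈ Finset.Ico j m, y k
  have hw0 (j m : ℕ) : 0 ≤ w j m := le_inf hu (Finset.sum_nonneg fun k _ => hy k)
  have hw (j : ℕ) : Monotone (w j) := fun m m' h => inf_le_inf_left _ <|
    Finset.sum_le_sum_of_subset_of_nonneg (Finset.Ico_subset_Ico_right h) fun k _ _ => hy k
  have hyw {j n m : ℕ} (hjn : j ≤ n) (hnm : n < m) : y n ≤ w j m :=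
    le_inf (hyu n) (Finset.single_le_sum (fun k _ => hy k) (Finset.mem_Ico.2 ⟨hjn, hnm⟩))
  choose N hN using fun j => hp.exists_forall_apply_sub_le_of_monotone hpu (hw j) (hw0 j)
    (fun m => inf_le_left) (hη j)
  let v (j : ℕ) : E := w j (N j)
  have hyv {j n : ℕ} (hjn : j ≤ n) : p (y n - v j)⁺ ≤ η j := by
    refine (hp.le_of_nonneg_of_le (posPart_nonneg _) (sup_le ?_ ?_)).trans
      (hN j (max (N j) (n + 1)) (le_max_left _ _))
    · exact sub_le_sub_right (hyw hjn (Nat.lt_of_succ_le (le_max_right _ _))) _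
    · exact sub_nonneg.2 (hw j (le_max_left _ _))
  let s (n : ℕ) : E := Nat.rec (v 0) (fun n t => t ⊓ v (n + 1)) n
  have hsv (n : ℕ) : s n ≤ v n := by cases n; exacts [le_rfl, inf_le_right]
  have hs0 (n : ℕ) : 0 ≤ s n := by
    induction n with
    | zero => exact hw0 _ _
    | succ n ih => exact le_inf ih (hw0 _ _)
  have hys (n : ℕ) : ∀ i ≤ n, p (y n - s i)⁺ ≤ ∑ j ∈ Finset.range (i + 1), η j := by
    intro i hi
    induction i with
    | zero =>
      rw [zero_add, Finset.sum_range_one]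
      exact hyv hi
    | succ i ih =>
      rw [Finset.sum_range_succ]
      calc p (y n - s (i + 1))⁺ ≤ p ((y n - s i)⁺ + (y n - v (i + 1))⁺) :=
            hp.le_of_nonneg_of_le (posPart_nonneg _) (posPart_sub_inf_le _ _ _)
        _ ≤ _ := (map_add_le_add p _ _).trans (add_le_add (ih (Nat.le_of_succ_le hi)) (hyv hi))
  refine ⟨s, antitone_nat_of_succ_le fun n => inf_le_left, hs0,
    fun n => (hsv n).trans inf_le_left, fun n => ⟨N n, (hsv n).trans inf_le_right⟩, fun n => ?_⟩
  exact (hys n n le_rfl).trans ((sum_le_hasSum _ (fun j _ => (hη j).le) hηc).trans hcδ)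

lemma exists_apply_le_of_summable (hp : IsRieszSeminorm p) (hpu : IsNullOnDisjointSeq p (sol {u}))
    {y : ℕ → E} (hy : ∀ n, 0 ≤ y n) (hyu : ∀ n, y n ≤ u) {F : ℕ → E →L[ℝ] ℝ}
    (hF : ∀ n, Monotone (F n)) (hFp : ∀ n z, 0 ≤ z → F n z ≤ p z)
    (hFy : ∀ n, Summable fun k => F n (y k)) {ε : ℝ} (hε : 0 < ε) : ∃ n, F n (y n) ≤ ε := by
  have hε3 : 0 < ε / 3 := by positivity
  obtain ⟨s, hs, hs0, hsu, hsum, hys⟩ := hp.exists_antitone_approx hpu hy hyu hε3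
  obtain ⟨N, hN⟩ := hp.exists_forall_apply_sub_le_of_monotone hpu (v := fun n => u - s n)
    (fun m n h => sub_le_sub_left (hs h) u) (fun n => sub_nonneg.2 (hsu n))
    (fun n => sub_le_self u (hs0 n)) hε3
  have htail := (tendsto_sum_nat_add fun k => F N (y k)).eventually_le_const hε3
  obtain ⟨n, hn, hNn⟩ := (htail.and (eventually_ge_atTop N)).exists
  have hFsn : F N (s n) ≤ ε / 3 := by
    obtain ⟨m, hm⟩ := hsum n
    have hFy0 (k : ℕ) : 0 ≤ F N (y k) := map_zero (F N) ▸ hF N (hy k)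
    calc F N (s n) ≤ ∑ k ∈ Finset.Ico n m, F N (y k) := (hF N hm).trans_eq (map_sum _ _ _)
      _ = ∑ k ∈ Finset.range (m - n), F N (y (k + n)) := by
        simp only [Finset.sum_Ico_eq_sum_range, add_comm n]
      _ ≤ ∑' k, F N (y (k + n)) :=
        ((summable_nat_add_iff n).2 (hFy N)).sum_le_tsum _ fun k _ => hFy0 _
      _ ≤ ε / 3 := hn
  have hFsN : F N (s N - s n) ≤ ε / 3 := by
    refine (hFp N _ (sub_nonneg.2 (hs hNn))).trans ?_
    simpa only [sub_sub_sub_cancel_left] using hN n hNn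
  have hFyN : F N (y N - s N) ≤ ε / 3 :=
    (hF N (le_posPart _)).trans ((hFp N _ (posPart_nonneg _)).trans (hys N))
  refine ⟨N, ?_⟩
  rw [map_sub] at hFsN hFyN
  linarith

lemma exists_monotone_forall_apply_lt (hp : IsRieszSeminorm p) (hpc : Continuous p)
    (hpu : IsNullOnDisjointSeq p (sol {u})) {ε : ℝ} (hε : 0 < ε) :
    ∃ G : E →L[ℝ] ℝ, Monotone G ∧ ∃ δ > 0, ∀ y, 0 ≤ y → y ≤ u → G y < δ → p y < ε := by
  have hhalf (n : ℕ) : (0 : ℝ) < (1 / 2) ^ n := by positivity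
  by_contra! h
  choose! y hy0 hyu hyG hyε using fun G hG n => h G hG ((1 / 2) ^ n) (hhalf n)
  choose! F hF hFy hFp using fun G n hG => hp.exists_monotone_eq hpc (hy0 G hG n)
  let S (n : ℕ) : E →L[ℝ] ℝ := Nat.rec 0 (fun n G => G + F G n) n
  have hS (n : ℕ) : Monotone (S n) := by
    induction n with
    | zero => exact monotone_const
    | succ n ih => exact ih.add (hF (S n) n ih)
  have hF0 (n : ℕ) {z : E} (hz : 0 ≤ z) : 0 ≤ F (S n) n z :=
    map_zero (F (S n) n) ▸ hF (S n) n (hS n) hz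
  have hS0 (n : ℕ) {z : E} (hz : 0 ≤ z) : 0 ≤ S n z := map_zero (S n) ▸ hS n hz
  have hSmono {z : E} (hz : 0 ≤ z) : Monotone fun n => S n z :=
    monotone_nat_of_le_succ fun n => le_add_of_nonneg_right (hF0 n hz)
  let x (n : ℕ) : E := y (S n) n
  have hx0 (n : ℕ) : 0 ≤ x n := hy0 (S n) (hS n) n
  have hFx {n k : ℕ} (hnk : n < k) : F (S n) n (x k) ≤ (1 / 2) ^ k :=
    calc F (S n) n (x k) ≤ S (n + 1) (x k) := le_add_of_nonneg_left (hS0 n (hx0 k))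
      _ ≤ S k (x k) := hSmono (hx0 k) hnk
      _ ≤ (1 / 2) ^ k := (hyG (S k) (hS k) k).le
  have hsum (n : ℕ) : Summable fun k => F (S n) n (x k) := by
    refine (summable_nat_add_iff (n + 1)).1 <|
      .of_nonneg_of_le (fun k => hF0 n (hx0 (k + (n + 1))))
        (fun k => hFx (n.lt_succ_self.trans_le (Nat.le_add_left (n + 1) k))) ?_
    exact (summable_nat_add_iff (n + 1)).2 summable_geometric_two
  obtain ⟨n, hn⟩ := hp.exists_apply_le_of_summable hpu hx0 (fun n => hyu (S n) (hS n) n)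
    (fun n => hF (S n) n (hS n)) (fun n => hFp (S n) n (hS n)) hsum (half_pos hε)
  have hεn : ε ≤ F (S n) n (x n) := (hyε (S n) (hS n) n).trans_eq (hFy (S n) n (hS n)).symm
  linarith

lemma tendsto_zero_of_tendsto_toWeakSpace (hp : IsRieszSeminorm p) (hpc : Continuous p)
    (hpu : IsNullOnDisjointSeq p (sol {u})) {ι : Type*} {l : Filter ι} {y : ι → E}
    (hy0 : ∀ i, 0 ≤ y i) (hyu : ∀ i, y i ≤ u)
    (hy : Tendsto (fun i => toWeakSpace ℝ E (y i)) l (𝓝 (toWeakSpace ℝ E 0))) :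
    Tendsto (fun i => p (y i)) l (𝓝 0) := by
  refine tendsto_order.2 ⟨fun a ha => .of_forall fun i => ha.trans_le (apply_nonneg p _),
    fun ε hε => ?_⟩
  obtain ⟨G, -, δ, hδ, hG⟩ := hp.exists_monotone_forall_apply_lt hpc hpu hε
  have hGy : Tendsto (fun i => G (y i)) l (𝓝 0) := map_zero G ▸ tendsto_toWeakSpace_iff.1 hy G
  exact (hGy.eventually_lt_const hδ).mono fun i hi => hG _ (hy0 i) (hyu i) hi

end IsRieszSeminorm

end OrderInterval

section AlmostDisjoint

variable {E : Type*} [NormedAddCommGroup E] [NormedSpace ℝ E] [Lattice E]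
  [IsOrderedAddMonoid E] [IsOrderedModule ℝ E]

lemma isDisjointSeq_posPart_sub {x s : ℕ → E} {X : E} (hs0 : ∀ n, 0 ≤ s n) (hX : 0 ≤ X)
    (hxs : ∀ m n, m < n → x m ≤ s n) (hxX : ∀ n, x n ≤ (2 : ℝ) ^ n • X) :
    IsDisjointSeq fun n => (x n - (4 : ℝ) ^ n • s n - (1 / 2 : ℝ) ^ n • X)⁺ := by
  refine isDisjointSeq_of_lt fun m n hmn => ?_
  have hxn : x n ≤ (4 : ℝ) ^ n • (1 / 2 : ℝ) ^ m • X :=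
    calc x n ≤ (2 : ℝ) ^ n • X := hxX n
      _ = (4 : ℝ) ^ n • (1 / 2 : ℝ) ^ n • X := by rw [smul_smul, ← mul_pow]; norm_num
      _ ≤ (4 : ℝ) ^ n • (1 / 2 : ℝ) ^ m • X := smul_le_smul_of_nonneg_left
          (smul_le_smul_of_nonneg_right
            (pow_le_pow_of_le_one (by norm_num) (by norm_num) hmn.le) hX) (by positivity)
  have hdisj : (x n - (4 : ℝ) ^ n • x m)⁺ ⊓ (x m - (1 / 2 : ℝ) ^ m • X)⁺ = 0 :=
    posPart_sub_smul_inf_posPart_sub_eq_zero (one_le_pow₀ (by norm_num)) hxn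
  rw [abs_of_nonneg (posPart_nonneg _), abs_of_nonneg (posPart_nonneg _), inf_comm]
  refine inf_eq_zero_of_le (posPart_nonneg _) (posPart_nonneg _) ?_ ?_ hdisj
  · refine posPart_mono ((sub_le_self _ (smul_nonneg (by positivity) hX)).trans ?_)
    exact sub_le_sub_left (smul_le_smul_of_nonneg_left (hxs m n hmn) (by positivity)) _
  · exact posPart_mono (sub_le_sub_right (sub_le_self _ (smul_nonneg (by positivity) (hs0 m))) _)

end AlmostDisjoint

section ApproximateOrderBound

variable {E : Type*} [NormedAddCommGroup E] [Lattice E] [HasSolidNorm E]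

lemma norm_le_of_mem_sol {S : Set E} {C : ℝ} (hS : ∀ x ∈ S, ‖x‖ ≤ C) {x : E} (hx : x ∈ sol S) :
    ‖x‖ ≤ C :=
  let ⟨y, hy, hxy⟩ := hx
  (norm_le_norm_of_abs_le_abs hxy).trans (hS y hy)

variable [NormedSpace ℝ E] [CompleteSpace E] [IsOrderedAddMonoid E] [IsOrderedModule ℝ E]

lemma exists_forall_abs_le_pow_smul {x : ℕ → E} {C : ℝ}
    (hx : ∀ n, ‖x n‖ ≤ C) : ∃ X, 0 ≤ X ∧ ∀ n, |x n| ≤ (2 : ℝ) ^ n • X := by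
  let y (n : ℕ) : E := (1 / 2 : ℝ) ^ n • |x n|
  have hy0 (n : ℕ) : 0 ≤ y n := smul_nonneg (by positivity) (abs_nonneg _)
  have hy : Summable y := by
    refine .of_norm_bounded (summable_geometric_two.mul_right C) fun n => ?_
    rw [norm_smul, Real.norm_of_nonneg (by positivity), norm_abs_eq_norm]
    exact mul_le_mul_of_nonneg_left (hx n) (by positivity)
  refine ⟨∑' n, y n, tsum_nonneg hy0, fun n => ?_⟩
  calc |x n| = (2 : ℝ) ^ n • y n := by
        rw [smul_smul, ← mul_pow, mul_one_div_cancel two_ne_zero, one_pow, one_smul]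
    _ ≤ (2 : ℝ) ^ n • ∑' n, y n :=
        smul_le_smul_of_nonneg_left (hy.le_tsum n fun k _ => hy0 k) (by positivity)

lemma IsRieszSeminorm.exists_forall_apply_posPart_abs_sub_le {p : Seminorm ℝ E}
    (hp : IsRieszSeminorm p) {S : Set E} {C : ℝ} (hS : ∀ x ∈ S, ‖x‖ ≤ C)
    (hpS : IsNullOnDisjointSeq p (sol S)) {ε : ℝ} (hε : 0 < ε) :
    ∃ u, 0 ≤ u ∧ ∀ x ∈ sol S, p (|x| - u)⁺ ≤ ε := by
  by_contra! h
  choose! f hfS hfε using h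
  let s (n : ℕ) : E := Nat.rec 0 (fun n t => t + |f ((4 : ℝ) ^ n • t)|) n
  let x (n : ℕ) : E := f ((4 : ℝ) ^ n • s n)
  have hs : Monotone s := monotone_nat_of_le_succ fun n => le_add_of_nonneg_right (abs_nonneg _)
  have hs0 (n : ℕ) : 0 ≤ s n := hs (Nat.zero_le n)
  have h4s (n : ℕ) : 0 ≤ (4 : ℝ) ^ n • s n := smul_nonneg (by positivity) (hs0 n)
  have hxS (n : ℕ) : x n ∈ sol S := hfS _ (h4s n)
  have hxs (m n : ℕ) (hmn : m < n) : |x m| ≤ s n :=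
    (le_add_of_nonneg_left (hs0 m) : |x m| ≤ s (m + 1)).trans (hs hmn)
  obtain ⟨X, hX, hxX⟩ := exists_forall_abs_le_pow_smul fun n => norm_le_of_mem_sol hS (hxS n)
  let e (n : ℕ) : E := (1 / 2 : ℝ) ^ n • X
  have he (n : ℕ) : 0 ≤ e n := smul_nonneg (by positivity) hX
  let w (n : ℕ) : E := (|x n| - (4 : ℝ) ^ n • s n - e n)⁺
  have hwS (n : ℕ) : w n ∈ sol S := by
    refine mem_sol_of_abs_le (hxS n) ?_
    rw [abs_of_nonneg (posPart_nonneg _)]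
    exact sup_le ((sub_le_self _ (he n)).trans (sub_le_self _ (h4s n))) (abs_nonneg _)
  have hw : Tendsto (fun n => p (w n)) atTop (𝓝 0) :=
    hpS w (isDisjointSeq_posPart_sub hs0 hX hxs hxX) hwS
  have hpe : Tendsto (fun n => p (e n)) atTop (𝓝 0) := by
    have h2 := tendsto_pow_atTop_nhds_zero_of_lt_one (r := (1 / 2 : ℝ)) (by norm_num) (by norm_num)
    simpa [e, map_smul_eq_mul] using h2.mul_const (p X)
  have hle (n : ℕ) : ε ≤ p (w n) + p (e n) := by
    refine (hfε _ (h4s n)).le.trans (hp.le_add_of_abs_le ?_)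
    rw [abs_of_nonneg (posPart_nonneg _)]
    have := posPart_add_le (|x n| - (4 : ℝ) ^ n • s n - e n) (e n)
    rwa [sub_add_cancel, posPart_of_nonneg (he n)] at this
  exact hε.not_ge (ge_of_tendsto' (by simpa only [add_zero] using hw.add hpe) hle)

end ApproximateOrderBound

section UnboundedAbsoluteWeakConvergence

variable {E : Type*} [NormedAddCommGroup E] [NormedSpace ℝ E] [Lattice E]

lemma UAWTendsto.comp {ι κ : Type*} {l : Filter ι} {m : Filter κ} {x : ι → E} {a : E} {φ : κ → ι}
    (hx : UAWTendsto x l a) (hφ : Tendsto φ m l) : UAWTendsto (x ∘ φ) m a :=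
  fun u hu => (hx u hu).comp hφ

variable [IsOrderedAddMonoid E] [IsOrderedModule ℝ E] [HasSolidNorm E]

lemma IsDisjointSeq.uawTendsto {x : ℕ → E} (hx : IsDisjointSeq x) : UAWTendsto x atTop 0 := by
  intro u hu
  have hxu (n : ℕ) : 0 ≤ |x n| ⊓ u := le_inf (abs_nonneg _) hu
  have hdisj : IsDisjointSeq fun n => |x n| ⊓ u :=
    hx.mono fun n => (abs_of_nonneg (hxu n)).trans_le inf_le_left
  simp only [sub_zero]
  refine tendsto_toWeakSpace_iff.2 fun f => ?_
  rw [map_zero]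
  exact (isRelativelyWeaklyCompact_singleton u).tendsto_of_isDisjointSeq hdisj
    (fun n => mem_sol_singleton_of_nonneg (hxu n) inf_le_right) f

lemma IsRieszSeminorm.tendsto_zero_of_uawTendsto [CompleteSpace E] {p : Seminorm ℝ E}
    (hp : IsRieszSeminorm p) (hpc : Continuous p) (hpu : ∀ u, IsNullOnDisjointSeq p (sol {u}))
    {S : Set E} {C : ℝ} (hS : ∀ x ∈ S, ‖x‖ ≤ C) (hpS : IsNullOnDisjointSeq p (sol S))
    {ι : Type*} {l : Filter ι} {x : ι → E} (hxS : ∀ i, x i ∈ sol S) (hx : UAWTendsto x l 0) :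
    Tendsto (fun i => p (x i)) l (𝓝 0) := by
  refine tendsto_order.2 ⟨fun a ha => .of_forall fun i => ha.trans_le (apply_nonneg p _),
    fun ε hε => ?_⟩
  obtain ⟨u, hu, hSu⟩ := hp.exists_forall_apply_posPart_abs_sub_le hS hpS (half_pos hε)
  have hxu : Tendsto (fun i => p (|x i| ⊓ u)) l (𝓝 0) :=
    hp.tendsto_zero_of_tendsto_toWeakSpace hpc (hpu u) (fun i => le_inf (abs_nonneg _) hu)
      (fun i => inf_le_right) (by simpa only [sub_zero] using hx u hu)
  filter_upwards [hxu.eventually_lt_const (half_pos hε)] with i hi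
  linarith [hp.le_apply_inf_add_apply_posPart_sub (x i) u, hSu (x i) (hxS i)]

variable {Y : Type*} [NormedAddCommGroup Y] [NormedSpace ℝ Y] {T : E →L[ℝ] Y} {S : Set E}

lemma IsAlmostDunfordPettis.isNullOnDisjointSeq (hT : IsAlmostDunfordPettis T)
    (hS : IsRelativelyWeaklyCompact S) : IsNullOnDisjointSeq (solidSeminorm T) (sol S) :=
  isNullOnDisjointSeq_solidSeminorm fun z hz hzS =>
    hT z hz <| tendsto_toWeakSpace_iff.2 fun f => by
      simpa only [map_zero] using hS.tendsto_of_isDisjointSeq hz hzS f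

lemma IsAlmostDunfordPettis.tendsto_of_uawTendsto [CompleteSpace E]
    (hT : IsAlmostDunfordPettis T) (hS : IsRelativelyWeaklyCompact S)
    {ι : Type*} {l : Filter ι} {x : ι → E} (hxS : ∀ i, x i ∈ sol S) (hx : UAWTendsto x l 0) :
    Tendsto (fun i => T (x i)) l (𝓝 0) := by
  obtain ⟨C, hC⟩ := hS.exists_norm_le
  refine squeeze_zero_norm (fun i => norm_apply_le_solidSeminorm T le_rfl) ?_
  exact (isRieszSeminorm_solidSeminorm T).tendsto_zero_of_uawTendsto (continuous_solidSeminorm T)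
    (fun u => hT.isNullOnDisjointSeq (isRelativelyWeaklyCompact_singleton u)) hC
    (hT.isNullOnDisjointSeq hS) hxS hx

lemma isAlmostDunfordPettis_of_isLWeaklyCompactOn
    (h : ∀ S : Set E, IsRelativelyWeaklyCompact S → IsLWeaklyCompactOn S T) :
    IsAlmostDunfordPettis T := fun x hx hx0 =>
  h _ (isRelativelyWeaklyCompact_range_of_tendsto hx0) x (fun n => ⟨x n, ⟨n, rfl⟩, le_rfl⟩)
    hx.uawTendsto

end UnboundedAbsoluteWeakConvergence

end BanachLatticeOps

theorem proposition3p17_general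
    {E : Type u} [NormedAddCommGroup E] [NormedSpace ℝ E] [CompleteSpace E]
    [Lattice E] [IsOrderedAddMonoid E] [IsOrderedModule ℝ E] [HasSolidNorm E]
    {Y : Type v} [NormedAddCommGroup Y] [NormedSpace ℝ Y]
    (T : E →L[ℝ] Y) :
    List.TFAE [
      IsAlmostDunfordPettis T,
      ∀ S : Set E, IsRelativelyWeaklyCompact S → IsLWeaklyCompactOn S T,
      ∀ S : Set E, IsRelativelyWeaklyCompact S →
        ∀ (ι : Type w) [Preorder ι] [IsDirectedOrder ι] [Nonempty ι] (x : ι → E),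
          (∀ i, x i ∈ sol S) → UAWTendsto x atTop 0 →
            Tendsto (fun i => T (x i)) atTop (𝓝 0),
      ∀ S : Set E, IsRelativelyWeaklyCompact S →
        ∀ x : ℕ → E, (∀ n, x n ∈ sol S) → UAWTendsto x atTop 0 →
          Tendsto (fun n => T (x n)) atTop (𝓝 0)] := by
  tfae_have 1 → 3 := fun hT S hS ι _ _ _ x hxS hx => hT.tendsto_of_uawTendsto hS hxS hx
  tfae_have 3 → 4 := fun h S hS x hxS hx => by
    -- item 3 quantifies over index sets in `Type w`, so the sequence is indexed by `ULift.{w} ℕ`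
    let e : ULift.{w} ℕ ≃o ℕ := ULift.orderIso
    exact (h S hS (ULift.{w} ℕ) (x ∘ e) (fun i => hxS (e i)) (hx.comp e.tendsto_atTop)).comp
      e.symm.tendsto_atTop
  tfae_have 4 → 2 := fun h => h
  tfae_have 2 → 1 := isAlmostDunfordPettis_of_isLWeaklyCompactOn
  tfae_finish

theorem proposition3p17
    {E : Type u} [NormedAddCommGroup E] [NormedSpace ℝ E] [CompleteSpace E]
    [Lattice E] [IsOrderedAddMonoid E] [IsOrderedModule ℝ E] [HasSolidNorm E]
    {Y : Type v} [NormedAddCommGroup Y] [NormedSpace ℝ Y] [CompleteSpace Y]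
    (T : E →L[ℝ] Y) :
    List.TFAE [
      IsAlmostDunfordPettis T,
      ∀ S : Set E, IsRelativelyWeaklyCompact S → IsLWeaklyCompactOn S T,
      ∀ S : Set E, IsRelativelyWeaklyCompact S →
        ∀ (ι : Type w) [Preorder ι] [IsDirectedOrder ι] [Nonempty ι] (x : ι → E),
          (∀ i, x i ∈ sol S) → UAWTendsto x atTop 0 →
            Tendsto (fun i => T (x i)) atTop (𝓝 0),
      ∀ S : Set E, IsRelativelyWeaklyCompact S →
        ∀ x : ℕ → E, (∀ n, x n ∈ sol S) → UAWTendsto x atTop 0 →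
          Tendsto (fun n => T (x n)) atTop (𝓝 0)] :=
  proposition3p17_general T
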